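/- **Setting.** There are $n$ replicas, at most $f$ of them Byzantine (arbitrary behaviour), $n>3f$; the others are *correct*. Every transaction $T$ has a digest, and "$T$ is ordered at position $p$" means that its digest is the entry at position $p$ of the replica's output list. Correct replicas run FairDAG-AB on top of a DAG-based consensus layer, as follows. *Vertices.* A correct replica gives each newly received valid transaction the current reading (a natural number) of its local timer, which never decreases, as ordering indicator, and appends (digest, indicator) to its pending list; a transaction already received is not listed again. In every round $r=0,1,2,\dots$ it proposes a vertex containing and clearing the pending list. A vertex of round $r>0$ has at least $n-f$ strong edges to vertices of round $r-1$, one of them to its creator's own vertex; a vertex of round $0$ has none. Every vertex has at most $f$ weak edges to vertices of earlier rounds. Vertices are reliably broadcast: no two correct replicas deliver different vertices for the same creator and round, and a vertex delivered by one correct replica is eventually delivered by all. A correct replica delivers a vertex only after the vertices it references, and only if it obeys the edge rules and continues its creator's local ordering, meaning that along that ordering the indicators never decrease and no digest is repeated. *DAG layer.* Replicas commit leader vertices of their local DAG. The subdag $A_L$ of a committed leader $L$ consists of the vertices reachable from $L$ (including $L$) that are not reachable from a leader committed earlier. The layer guarantees: (Agreement) a leader committed by one correct replica is eventually committed by every correct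 replica; (Total ascending order) if a correct replica commits $L$ before $L'$, then $L$ has a smaller round than $L'$ and no correct replica commits $L'$ before $L$; (Validity) if a correct replica broadcasts a vertex $v$, every correct replica eventually commits a leader $L$ with $v\in A_L$. The subdags are sent in commit order to the fairness layer, which eventually processes each of them. *Fairness layer.* For a digest $d$, let $seen_d[i]$ and $committed_d[i]$ be the indicator of $d$ from replica $i$ in the delivered vertices, respectively in the processed subdags ($\infty$ if there is none), and let $highest[i]$ be the highest indicator in the delivered vertices of replica $i$ ($0$ if there is none). On processing a subdag, the replica updates the $committed_d$. Every $d$ without an assigned ordering indicator (AOI) for which $committed_d$ has at least $n-f$ finite entries gets as AOI, once and for all, the $(f+1)$-th smallest entry of $committed_d$. Then $LPAOI_{\min}$ is computed as the minimum ($\infty$ if there is no such $d$), over all digests $d$ still without an AOI, including those not seen yet, of $LPAOI(d)$, the $(f+1)$-th smallest of the values $\min(seen_d[i],highest[i])$, $1\le i\le n$. Finally all digests with AOI less than $LPAOI_{\min}$ that are not yet in the output list are appended to it in ascending order of AOI, ties being broken by a fixed total order on digests. **Theorem (FairDAG-AB Safety).** In every such execution, if a correct replica orders a transaction $T$ at position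 $p$ in its final ordering, then every correct replica eventually orders $T$ at position $p$. -/

import Mathlib

namespace FairDAG

/-- A vertex proposed by replica `creator` in round `round`. References name vertices by creator and
round: `strong` lists the creators of the referenced vertices of the previous round, `weak` the
other referenced vertices. `lo` is the slice of the local ordering carried by the vertex, the list
of pairs (digest, ordering indicator), i.e. the lists `dgs` and `ois` zipped together. -/
structure Vertex (n : ℕ) (D : Type*) where
  creator : Fin n
  round : ℕ
  strong : Finset (Fin n)
  weak : Finset (Fin n × ℕ)
  lo : List (D × ℕ)

/-- There is a (strong or weak) edge from `v` to `w`. -/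
def Vertex.Refs {n : ℕ} {D : Type*} (v w : Vertex n D) : Prop :=
  (w.round + 1 = v.round ∧ w.creator ∈ v.strong) ∨ (w.creator, w.round) ∈ v.weak

/-- The edge rules: after round `0` at least `n - f` strong edges, one of them to the creator's own
previous vertex; at most `f` weak edges, all of them to earlier rounds. -/
def Vertex.ValidEdges {n : ℕ} {D : Type*} (f : ℕ) (v : Vertex n D) : Prop :=
  (v.round = 0 → v.strong = ∅) ∧
  (0 < v.round → n - f ≤ v.strong.card ∧ v.creator ∈ v.strong) ∧
  v.weak.card ≤ f ∧ ∀ e ∈ v.weak, e.2 < v.round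

/-- Every vertex referenced by `v` is in the local DAG `G`. -/
def Vertex.ParentsIn {n : ℕ} {D : Type*} (G : Finset (Vertex n D)) (v : Vertex n D) : Prop :=
  (∀ c ∈ v.strong, ∃ w ∈ G, w.creator = c ∧ w.round + 1 = v.round) ∧
  ∀ e ∈ v.weak, ∃ w ∈ G, (w.creator, w.round) = e

/-- `v` continues the local ordering of its creator: along that ordering (the vertices of the
creator in `G` from earlier rounds, then `v`) the ordering indicators never decrease and no digest
is listed twice. -/
def Vertex.ValidLO {n : ℕ} {D : Type*} (G : Finset (Vertex n D)) (v : Vertex n D) : Prop :=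
  v.lo.Pairwise (fun a b => a.2 ≤ b.2 ∧ a.1 ≠ b.1) ∧
  ∀ w ∈ G, w.creator = v.creator → w.round < v.round →
    ∀ a ∈ w.lo, ∀ b ∈ v.lo, a.2 ≤ b.2 ∧ a.1 ≠ b.1

open Classical in
/-- The causal history of `L` in the local DAG `G`: the vertices reachable from `L`, with `L`. -/
noncomputable def causalHistory {n : ℕ} {D : Type*} (G : Finset (Vertex n D)) (L : Vertex n D) :
    Finset (Vertex n D) :=
  G.filter fun w => Relation.ReflTransGen (fun a b => b ∈ G ∧ a.Refs b) L w

/-- The `k`-th smallest entry of `w`, counted with multiplicity (`1 ≤ k ≤ n`): the least value `x`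
such that at least `k` entries are at most `x`. -/
noncomputable def kthSmallest {n : ℕ} (k : ℕ) (w : Fin n → ℕ∞) : ℕ∞ :=
  sInf {x | k ≤ (Finset.univ.filter fun i => w i ≤ x).card}

/-- The local variables of a replica. The value `⊤` of an ordering indicator stands for `∞`. -/
structure State (n : ℕ) (D : Type*) where
  /-- last reading of the local timer -/
  timer : ℕ
  /-- digests of the transactions accepted from clients -/
  received : Set D
  /-- pending local ordering `dgs`, `ois` -/
  pending : List (D × ℕ)
  /-- `current_round` -/
  round : ℕ
  /-- local DAG view: the delivered vertices -/
  dag : Finset (Vertex n D)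
  /-- union of the causal histories of the committed leaders -/
  done : Finset (Vertex n D)
  /-- subdags sent to, and not yet received by, the fairness layer -/
  queue : List (Finset (Vertex n D))
  highest : Fin n → ℕ
  seen : D → Fin n → ℕ∞
  committed : D → Fin n → ℕ∞
  /-- assigned ordering indicators -/
  aoi : D → ℕ∞
  /-- `txns_w_assigned_oi`: the digests with an assigned ordering indicator not yet ordered -/
  txns : Set D
  /-- the final ordering output so far -/
  log : List D

def State.init (n : ℕ) (D : Type*) : State n D where
  timer := 0
  received := ∅
  pending := []
  round := 0
  dag := ∅
  done := ∅
  queue := []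
  highest := fun _ => 0
  seen := fun _ _ => ⊤
  committed := fun _ _ => ⊤
  aoi := fun _ => ⊤
  txns := ∅
  log := []

/-- The events of a replica: receive a client transaction when the local timer shows `now`;
propose and broadcast a vertex with given edges; deliver a vertex; commit a leader vertex and send
its subdag to the fairness layer; the fairness layer receives the next subdag. -/
inductive Event (n : ℕ) (D Tx : Type*) where
  | receive (T : Tx) (now : ℕ)
  | propose (strong : Finset (Fin n)) (weak : Finset (Fin n × ℕ))
  | deliver (v : Vertex n D)
  | commit (L : Vertex n D)
  | process

/-- The vertex that replica `i` builds from its state and the given edges. -/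
def newVertex {n : ℕ} {D : Type*} (i : Fin n) (s : State n D)
    (strong : Finset (Fin n)) (weak : Finset (Fin n × ℕ)) : Vertex n D :=
  ⟨i, s.round, strong, weak, s.pending⟩

open Classical in
/-- The subdag of `L` when `L` is committed in state `s`: the part of its causal history outside the
causal histories of the leaders committed before. -/
noncomputable def subdag {n : ℕ} {D : Type*} (s : State n D) (L : Vertex n D) :
    Finset (Vertex n D) :=
  causalHistory s.dag L \ s.done

/-- For all pairs `(d, oi)` in `v`: entry `v.creator` of the vector of `d` is set to `oi`. -/
def record {n : ℕ} {D : Type*} [DecidableEq D] (o : D → Fin n → ℕ∞) (v : Vertex n D) :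
    D → Fin n → ℕ∞ :=
  v.lo.foldl (fun o p => Function.update o p.1 (Function.update (o p.1) v.creator (p.2 : ℕ∞))) o

/-- The digest `d` has at least `n - f` committed ordering indicators. -/
def Enough {n : ℕ} {D : Type*} (f : ℕ) (committed : D → Fin n → ℕ∞) (d : D) : Prop :=
  n - f ≤ (Finset.univ.filter fun i => committed d i ≠ ⊤).card

/-- The lowest assigned ordering indicator that `d` could still get. -/
noncomputable def lpaoi {n : ℕ} {D : Type*} (f : ℕ) (s : State n D) (d : D) : ℕ∞ :=
  kthSmallest (f + 1) fun i => min (s.seen d i) (s.highest i : ℕ∞)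

open Classical in
/-- The list of the elements of `S` in ascending order of `key`, ties being broken by the order of
`D`. (It is only used for finite `S`.) -/
noncomputable def sortBy {D : Type*} [LinearOrder D] (key : D → ℕ∞) (S : Set D) : List D :=
  if h : S.Finite then
    ((h.toFinset.image fun d => toLex (key d, d)).sort (· ≤ ·)).map fun x => (ofLex x).2
  else []

open Classical in
/-- The fairness layer receives the subdag `A`: it updates the committed ordering indicators, assigns
ordering indicators, computes the minimal `LPAOI` of the digests without one, and orders the
assigned digests below that threshold. -/
noncomputable def fairnessStep {n : ℕ} {D : Type*} [LinearOrder D] (f : ℕ)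
    (A : Finset (Vertex n D)) (s : State n D) : State n D :=
  let committed := A.toList.foldl record s.committed
  let aoi : D → ℕ∞ := fun d =>
    if s.aoi d = ⊤ ∧ Enough f committed d then kthSmallest (f + 1) (committed d) else s.aoi d
  let txns := s.txns ∪ {d | s.aoi d = ⊤ ∧ Enough f committed d}
  let lpaoiMin : ℕ∞ := ⨅ d, ⨅ _ : aoi d = ⊤, lpaoi f s d
  let batch := {d ∈ txns | aoi d < lpaoiMin}
  { s with
    committed := committed
    aoi := aoi
    txns := txns \ batch
    log := s.log ++ sortBy aoi batch }

open Classical in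
/-- The effect of an event on the state of a correct replica. -/
noncomputable def step {n : ℕ} {D Tx : Type*} [LinearOrder D] (f : ℕ) (digest : Tx → D)
    (valid : Tx → Prop) (e : Event n D Tx) (s : State n D) : State n D :=
  match e with
  | .receive T now =>
    if valid T ∧ digest T ∉ s.received then
      { s with
        timer := now
        received := insert (digest T) s.received
        pending := s.pending ++ [(digest T, now)] }
    else { s with timer := now }
  | .propose _ _ => { s with round := s.round + 1, pending := [] }
  | .deliver v =>
    { s with
      dag := insert v s.dag
      highest := Function.update s.highest v.creator
        (v.lo.foldl (fun m p => max m p.2) (s.highest v.creator))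
      seen := record s.seen v }
  | .commit L =>
    { s with
      done := s.done ∪ causalHistory s.dag L
      queue := s.queue ++ [subdag s L] }
  | .process =>
    match s.queue with
    | [] => s
    | A :: q => fairnessStep f A { s with queue := q }

/-- The conditions under which a correct replica `i` in state `s` performs an event: its timer does
not run backwards; it proposes only vertices obeying the edge rules over its local DAG; it adds to
its DAG only valid vertices, each once and after the vertices it references; it commits only
vertices of its DAG; the fairness layer waits for a subdag. -/
def Enabled {n : ℕ} {D Tx : Type*} (f : ℕ) (i : Fin n) (s : State n D) : Event n D Tx → Prop
  | .receive _ now => s.timer ≤ now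
  | .propose strong weak =>
    (newVertex i s strong weak).ValidEdges f ∧ (newVertex i s strong weak).ParentsIn s.dag
  | .deliver v => v ∉ s.dag ∧ v.ValidEdges f ∧ v.ParentsIn s.dag ∧ v.ValidLO s.dag
  | .commit L => L ∈ s.dag
  | .process => s.queue ≠ []

/-- The state of replica `i` after the first `t` of its events `ev i 0, ev i 1, …`. -/
noncomputable def stateAt {n : ℕ} {D Tx : Type*} [LinearOrder D] (f : ℕ) (digest : Tx → D)
    (valid : Tx → Prop) (ev : Fin n → ℕ → Event n D Tx) (i : Fin n) : ℕ → State n D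
  | 0 => State.init n D
  | t + 1 => step f digest valid (ev i t) (stateAt f digest valid ev i t)

/-- The correct replicas follow the protocol: they perform only enabled events, propose a vertex in
every round, and their fairness layer receives every subdag sent to it. Nothing is required of the
other replicas. -/
structure FollowsProtocol {n : ℕ} {D Tx : Type*} [LinearOrder D] (f : ℕ) (digest : Tx → D)
    (valid : Tx → Prop) (correct : Finset (Fin n)) (ev : Fin n → ℕ → Event n D Tx) : Prop where
  enabled : ∀ i ∈ correct, ∀ t, Enabled f i (stateAt f digest valid ev i t) (ev i t)
  proposes : ∀ i ∈ correct, ∀ r, ∃ t strong weak,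
    (stateAt f digest valid ev i t).round = r ∧ ev i t = .propose strong weak
  processes : ∀ i ∈ correct, ∀ t, (stateAt f digest valid ev i t).queue ≠ [] →
    ∃ t' ≥ t, ev i t' = .process

/-- Vertices are disseminated by reliable broadcast: correct replicas never deliver two different
vertices for the same creator and round, and what one of them delivers, all eventually deliver. -/
structure ReliableBroadcast {n : ℕ} {D Tx : Type*} [LinearOrder D] (f : ℕ) (digest : Tx → D)
    (valid : Tx → Prop) (correct : Finset (Fin n)) (ev : Fin n → ℕ → Event n D Tx) : Prop where
  consistency : ∀ i ∈ correct, ∀ j ∈ correct, ∀ t t',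
    ∀ v ∈ (stateAt f digest valid ev i t).dag, ∀ w ∈ (stateAt f digest valid ev j t').dag,
      v.creator = w.creator → v.round = w.round → v = w
  totality : ∀ i ∈ correct, ∀ j ∈ correct, ∀ t,
    ∀ v ∈ (stateAt f digest valid ev i t).dag, ∃ t', v ∈ (stateAt f digest valid ev j t').dag

/-- The guarantees that define a DAG-based consensus layer: agreement, total ascending order and
validity of the commits. -/
structure DAGConsensus {n : ℕ} {D Tx : Type*} [LinearOrder D] (f : ℕ) (digest : Tx → D)
    (valid : Tx → Prop) (correct : Finset (Fin n)) (ev : Fin n → ℕ → Event n D Tx) : Prop where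
  agreement : ∀ i ∈ correct, ∀ j ∈ correct, ∀ t L, ev i t = .commit L → ∃ t', ev j t' = .commit L
  totalAscendingOrder : ∀ i ∈ correct, ∀ t t' L L', t < t' →
    ev i t = .commit L → ev i t' = .commit L' →
      L.round < L'.round ∧
      ¬ ∃ j ∈ correct, ∃ u u', u < u' ∧ ev j u = .commit L' ∧ ev j u' = .commit L
  validity : ∀ i ∈ correct, ∀ t strong weak, ev i t = .propose strong weak →
    ∀ j ∈ correct, ∃ t' L, ev j t' = .commit L ∧
      newVertex i (stateAt f digest valid ev i t) strong weak ∈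
        subdag (stateAt f digest valid ev j t') L

/-- After `t` events, replica `i` has ordered `T` at position `p` (counted from `0`). -/
def OrdersAt {n : ℕ} {D Tx : Type*} [LinearOrder D] (f : ℕ) (digest : Tx → D)
    (valid : Tx → Prop) (ev : Fin n → ℕ → Event n D Tx) (i : Fin n) (t : ℕ) (T : Tx) (p : ℕ) :
    Prop :=
  (stateAt f digest valid ev i t).log[p]? = some (digest T)

end FairDAG

namespace FairDAG

/-! Let `α d` be the AOI that `d` eventually gets (`finalAOI`), and order the digests by `(α d, d)`.
The log of a correct replica is at all times an initial segment of this order, so any two logs are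
prefix-comparable (`log_prefix_or_prefix`). What one correct replica orders, each of them eventually
orders (`exists_mem_log`). Since logs have no repetitions, the positions agree.

`α` is common to all: committed leaders ascend in round and are agreed upon, and a leader has the
same causal history everywhere, so the processed subdags are prefix-comparable
(`processed_prefix_or_prefix`). AOIs depend on these subdags only (`outcome_processed`).

Logs are initial segments because `lpaoi` never exceeds `α` (`lpaoi_le_finalAOI`): a vertex listing
`d` is either delivered already, and `seen` holds its indicator, or it will continue its creator's
local ordering, and its indicator is at least `highest`. So digests without an AOI end up at or
above the threshold, and all assigned digests below it are ordered.

For progress, a proposal in every round forces infinitely many commits, hence infinitely many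
processing events. As `lpaoi` grows with the local DAG, a replica that has caught up with another
one has at least its threshold. -/

/-! ### Lists -/

/-- Two lists that are strictly sorted by `key`, each of which contains the elements of the other
one that lie below one of its own elements, are comparable for the prefix order. -/
theorem prefix_or_prefix_of_pairwise_lt {α β : Type*} [LinearOrder β] (key : α → β)
    {l l' : List α} (hl : l.Pairwise (key · < key ·)) (hl' : l'.Pairwise (key · < key ·))
    (hinj : ∀ a ∈ l, ∀ b ∈ l', key a = key b → a = b)
    (h : ∀ a ∈ l, ∀ b ∈ l', key b < key a → b ∈ l)
    (h' : ∀ a ∈ l, ∀ b ∈ l', key a < key b → a ∈ l') :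
    l <+: l' ∨ l' <+: l := by
  induction l generalizing l' with
  | nil => exact .inl List.nil_prefix
  | cons a l ih =>
    cases l' with
    | nil => exact .inr List.nil_prefix
    | cons b l' =>
      rw [List.pairwise_cons] at hl hl'
      have hab : a = b := by
        rcases lt_trichotomy (key a) (key b) with hlt | heq | hlt
        · rcases List.mem_cons.1 (h' a (by simp) b (by simp) hlt) with e | e
          · exact e
          · exact absurd (hl'.1 a e) hlt.not_gt
        · exact hinj a (by simp) b (by simp) heq
        · rcases List.mem_cons.1 (h a (by simp) b (by simp) hlt) with e | e
          · exact e.symm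
          · exact absurd (hl.1 b e) hlt.not_gt
      subst hab
      simp only [List.prefix_cons_inj]
      refine ih hl.2 hl'.2 (fun x hx y hy => hinj x (by simp [hx]) y (by simp [hy]))
        (fun x hx y hy hlt => ?_) (fun x hx y hy hlt => ?_)
      · rcases List.mem_cons.1 (h x (by simp [hx]) y (by simp [hy]) hlt) with e | e
        · exact absurd (hl'.1 y hy) (by simp [e])
        · exact e
      · rcases List.mem_cons.1 (h' x (by simp [hx]) y (by simp [hy]) hlt) with e | e
        · exact absurd (hl.1 x hx) (by simp [e])
        · exact e

/-- The absence of repetitions matters when `l'` is the shorter list: the index of `a` in `l'` is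
also one in `l`, hence equal to `p`. -/
theorem getElem?_eq_some_of_prefix_or_prefix {α : Type*} {l l' : List α} (hl : l.Nodup)
    (h : l <+: l' ∨ l' <+: l) {p : ℕ} {a : α} (ha : l[p]? = some a) (ha' : a ∈ l') :
    l'[p]? = some a := by
  rcases h with h | h
  · obtain ⟨m, rfl⟩ := h
    have hp := (List.getElem?_eq_some_iff.1 ha).1
    rw [List.getElem?_append_left hp, ha]
  · obtain ⟨m, rfl⟩ := h
    obtain ⟨q, hq⟩ := List.mem_iff_getElem?.1 ha'
    have hq' := (List.getElem?_eq_some_iff.1 hq).1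
    have hq2 : (l' ++ m)[q]? = some a := by rw [List.getElem?_append_left hq', hq]
    rw [(List.getElem?_inj (List.getElem?_eq_some_iff.1 ha).1 hl).1 (ha.trans hq2.symm), hq]

theorem prefix_or_prefix_of_prefix {α : Type*} {l l' m m' : List α} (h : m <+: m' ∨ m' <+: m)
    (hl : l <+: m) (hl' : l' <+: m') : l <+: l' ∨ l' <+: l := by
  rcases h with h | h
  · exact List.prefix_or_prefix_of_prefix (hl.trans h) hl'
  · exact List.prefix_or_prefix_of_prefix hl (hl'.trans h)

theorem foldl_max_snd_le_iff {α : Type*} (l : List (α × ℕ)) (m b : ℕ) :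
    l.foldl (fun m p => max m p.2) m ≤ b ↔ m ≤ b ∧ ∀ p ∈ l, p.2 ≤ b := by
  induction l generalizing m with
  | nil => simp
  | cons a l ih => simp [ih, and_assoc]

/-! ### Order statistics and sorting -/

theorem kthSmallest_mono {n : ℕ} (k : ℕ) {w w' : Fin n → ℕ∞} (h : w ≤ w') :
    kthSmallest k w ≤ kthSmallest k w' :=
  sInf_le_sInf fun _ hx => le_trans (α := ℕ) hx
    (Finset.card_le_card (Finset.monotone_filter_right _ fun i _ hi => (h i).trans hi))

theorem mem_sortBy {D : Type*} [LinearOrder D] {key : D → ℕ∞} {S : Set D} (hS : S.Finite) {d : D} :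
    d ∈ sortBy key S ↔ d ∈ S := by
  simp [sortBy, hS]

theorem mem_of_mem_sortBy {D : Type*} [LinearOrder D] {key : D → ℕ∞} {S : Set D} {d : D}
    (hd : d ∈ sortBy key S) : d ∈ S := by
  by_cases hS : S.Finite
  · exact (mem_sortBy hS).1 hd
  · simp [sortBy, hS] at hd

theorem pairwise_sortBy {D : Type*} [LinearOrder D] (key : D → ℕ∞) (S : Set D) :
    (sortBy key S).Pairwise fun a b => toLex (key a, a) < toLex (key b, b) := by
  classical
  unfold sortBy
  split_ifs with hS
  · rw [List.pairwise_map]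
    refine List.Pairwise.imp_of_mem ?_ (Finset.sortedLT_sort _).pairwise
    intro x y hx hy hxy
    simp only [Finset.mem_sort, Finset.mem_image] at hx hy
    obtain ⟨a, -, rfl⟩ := hx
    obtain ⟨b, -, rfl⟩ := hy
    exact hxy
  · exact List.Pairwise.nil

/-! ### Recording the indicators of a vertex -/

section Record

variable {n : ℕ} {D : Type*} [DecidableEq D]

theorem record_eq_or (o : D → Fin n → ℕ∞) (v : Vertex n D) (d : D) (r : Fin n) :
    (record o v d r = o d r ∧ (v.creator = r → ∀ x, (d, x) ∉ v.lo)) ∨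
      v.creator = r ∧ ∃ x : ℕ, (d, x) ∈ v.lo ∧ record o v d r = x := by
  unfold record
  generalize v.lo = l
  -- The last write wins, so the list is taken apart at its end.
  induction l using List.reverseRecOn with
  | nil => simp
  | append_singleton l p ih =>
    obtain ⟨e, y⟩ := p
    simp only [List.foldl_append, List.foldl_cons, List.foldl_nil]
    by_cases hr : v.creator = r
    · by_cases hd : e = d
      · subst hd hr
        exact .inr ⟨rfl, y, by simp⟩
      · rcases ih with ⟨h, h'⟩ | ⟨-, x, hx, h⟩
        · refine .inl ⟨?_, fun _ x => ?_⟩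
          · simpa [Function.update_of_ne (Ne.symm hd)] using h
          · simpa [Ne.symm hd] using h' hr x
        · refine .inr ⟨hr, x, by simp [hx], ?_⟩
          simpa [Function.update_of_ne (Ne.symm hd)] using h
    · rcases ih with ⟨h, -⟩ | ⟨h, -⟩
      · refine .inl ⟨?_, fun h => absurd h hr⟩
        by_cases hd : e = d
        · subst hd
          simpa [Function.update_of_ne (Ne.symm hr)] using h
        · simpa [Function.update_of_ne (Ne.symm hd)] using h
      · exact absurd h hr

theorem record_eq_of_mem {o : D → Fin n → ℕ∞} {v : Vertex n D} {d : D} {x : ℕ}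
    (hv : v.lo.Pairwise fun a b => a.1 ≠ b.1) (hx : (d, x) ∈ v.lo) :
    record o v d v.creator = x := by
  rcases record_eq_or o v d v.creator with ⟨-, h⟩ | ⟨-, y, hy, h⟩
  · exact absurd hx (h rfl x)
  · have hnd : (v.lo.map Prod.fst).Nodup := List.pairwise_map.2 hv
    have hxy := List.inj_on_of_nodup_map hnd hx hy rfl
    rw [h, (Prod.mk.inj hxy).2]

theorem le_foldl_record {o : D → Fin n → ℕ∞} {l : List (Vertex n D)} {d : D} {w : Fin n → ℕ∞}
    (ho : ∀ r, w r ≤ o d r) (hl : ∀ v ∈ l, ∀ x : ℕ, (d, x) ∈ v.lo → w v.creator ≤ x) (r : Fin n) :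
    w r ≤ l.foldl record o d r := by
  induction l generalizing o with
  | nil => exact ho r
  | cons v l ih =>
    refine ih (fun r => ?_) fun u hu => hl u (by simp [hu])
    rcases record_eq_or o v d r with ⟨h, -⟩ | ⟨rfl, x, hx, h⟩
    · rw [h]; exact ho r
    · rw [h]; exact hl v (by simp) x hx

end Record

/-! ### The part of the fairness layer that depends on the subdags only -/

section Outcome

variable {n : ℕ} {D : Type*} [LinearOrder D]

open Classical in
/-- The committed and the assigned ordering indicators after one more subdag. -/
noncomputable def assign (f : ℕ) (p : (D → Fin n → ℕ∞) × (D → ℕ∞)) (A : Finset (Vertex n D)) :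
    (D → Fin n → ℕ∞) × (D → ℕ∞) :=
  (A.toList.foldl record p.1, fun d =>
    if p.2 d = ⊤ ∧ Enough f (A.toList.foldl record p.1) d then
      kthSmallest (f + 1) (A.toList.foldl record p.1 d)
    else p.2 d)

/-- The committed and the assigned ordering indicators after the subdags `P`. -/
noncomputable def outcome (f : ℕ) (P : List (Finset (Vertex n D))) :
    (D → Fin n → ℕ∞) × (D → ℕ∞) :=
  P.foldl (assign f) (fun _ _ => ⊤, fun _ => ⊤)

theorem outcome_concat (f : ℕ) (P : List (Finset (Vertex n D))) (A : Finset (Vertex n D)) :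
    outcome f (P ++ [A]) = assign f (outcome f P) A := by
  simp [outcome]

/-- `assign` changes only AOIs that are still `⊤`. -/
theorem outcome_snd_eq_of_prefix {f : ℕ} {P P' : List (Finset (Vertex n D))} (h : P <+: P') {d : D}
    (hd : (outcome f P).2 d ≠ ⊤) : (outcome f P').2 d = (outcome f P).2 d := by
  obtain ⟨Q, rfl⟩ := h
  induction Q using List.reverseRecOn with
  | nil => simp
  | append_singleton Q A ih =>
    rw [← List.append_assoc, outcome_concat, ← ih]
    have : (outcome f (P ++ Q)).2 d ≠ ⊤ := by rwa [ih]
    simp [assign, this]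

/-- The bound `w` is arbitrary because it serves twice: as the vector that enters `lpaoi`, and as
the constant `⊤` for digests that occur in no processed vertex. -/
theorem le_outcome {f : ℕ} {P : List (Finset (Vertex n D))} {d : D} {w : Fin n → ℕ∞}
    (h : ∀ A ∈ P, ∀ v ∈ A, ∀ x : ℕ, (d, x) ∈ v.lo → w v.creator ≤ x) :
    (∀ r, w r ≤ (outcome f P).1 d r) ∧ kthSmallest (f + 1) w ≤ (outcome f P).2 d := by
  induction P using List.reverseRecOn with
  | nil => simp [outcome]
  | append_singleton P A ih =>
    obtain ⟨h₁, h₂⟩ := ih fun B hB => h B (by simp [hB])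
    have h₃ : ∀ r, w r ≤ A.toList.foldl record (outcome f P).1 d r :=
      le_foldl_record h₁ fun v hv => h A (by simp) v (by simpa using hv)
    rw [outcome_concat]
    refine ⟨h₃, ?_⟩
    simp only [assign]
    split_ifs
    · exact kthSmallest_mono _ h₃
    · exact h₂

/-- Since `n - f > 0`, such a digest occurs in one of the finitely many processed vertices.
Finiteness is essential, as `sortBy` returns `[]` on infinite sets. -/
theorem finite_enough {f : ℕ} (hf : f < n) (P : List (Finset (Vertex n D))) :
    {d | Enough f (outcome f P).1 d}.Finite := by
  have hfin : (⋃ A ∈ {A | A ∈ P}, ⋃ v ∈ (A : Set (Vertex n D)),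
      Prod.fst '' {p | p ∈ v.lo}).Finite :=
    (List.finite_toSet P).biUnion fun A _ => A.finite_toSet.biUnion fun v _ =>
      (List.finite_toSet v.lo).image _
  refine hfin.subset fun d hd => ?_
  by_contra hnot
  have h := (le_outcome (f := f) (P := P) (d := d) (w := fun _ => ⊤)
    fun A hA v hv x hx => absurd (by
      simp only [Set.mem_iUnion]
      exact ⟨A, hA, v, hv, (d, x), hx, rfl⟩) hnot).1
  have h0 : (Finset.univ.filter fun i => (outcome f P).1 d i ≠ ⊤) = ∅ := by
    ext r
    simpa using h r
  simp only [Set.mem_ofPred_eq, Enough, h0, Finset.card_empty] at hd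
  omega

end Outcome

/-! ### Vertices and causal histories -/

section Vertex

variable {n : ℕ} {D : Type*}

theorem Vertex.ParentsIn.mono {G G' : Finset (Vertex n D)} (h : G ⊆ G') {v : Vertex n D}
    (hv : v.ParentsIn G) : v.ParentsIn G' :=
  ⟨fun c hc => (hv.1 c hc).imp fun _ hw => ⟨h hw.1, hw.2⟩,
    fun e he => (hv.2 e he).imp fun _ hw => ⟨h hw.1, hw.2⟩⟩

theorem mem_causalHistory {G : Finset (Vertex n D)} {L w : Vertex n D} :
    w ∈ causalHistory G L ↔
      w ∈ G ∧ Relation.ReflTransGen (fun a b => b ∈ G ∧ a.Refs b) L w := by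
  simp [causalHistory]

theorem mem_subdag {s : State n D} {L v : Vertex n D} :
    v ∈ subdag s L ↔ v ∈ causalHistory s.dag L ∧ v ∉ s.done := by
  simp [subdag]

end Vertex

/-! ### The effect of the events -/

section Step

variable {n f : ℕ} {D Tx : Type*} [LinearOrder D] {digest : Tx → D} {valid : Tx → Prop}

theorem step_of_ne_deliver {e : Event n D Tx} (he : ∀ v, e ≠ .deliver v) (s : State n D) :
    (step f digest valid e s).dag = s.dag ∧ (step f digest valid e s).seen = s.seen ∧
      (step f digest valid e s).highest = s.highest := by
  cases e with
  | receive T now => unfold step; dsimp only; split_ifs <;> simp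
  | propose => simp [step]
  | deliver v => exact absurd rfl (he v)
  | commit => simp [step]
  | process => unfold step; dsimp only; split <;> simp [fairnessStep]

theorem step_of_ne_process {e : Event n D Tx} (he : e ≠ .process) (s : State n D) :
    (step f digest valid e s).committed = s.committed ∧ (step f digest valid e s).aoi = s.aoi ∧
      (step f digest valid e s).txns = s.txns ∧ (step f digest valid e s).log = s.log := by
  cases e with
  | receive T now => unfold step; dsimp only; split_ifs <;> simp
  | process => exact absurd rfl he
  | _ => simp [step]

theorem step_of_ne_commit {e : Event n D Tx} (he : ∀ L, e ≠ .commit L) (s : State n D) :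
    (step f digest valid e s).done = s.done := by
  cases e with
  | receive T now => unfold step; dsimp only; split_ifs <;> simp
  | commit L => exact absurd rfl (he L)
  | process => unfold step; dsimp only; split <;> simp [fairnessStep]
  | _ => simp [step]

theorem step_queue_of_ne {e : Event n D Tx} (he : ∀ L, e ≠ .commit L) (he' : e ≠ .process)
    (s : State n D) : (step f digest valid e s).queue = s.queue := by
  cases e with
  | receive T now => unfold step; dsimp only; split_ifs <;> simp
  | commit L => exact absurd rfl (he L)
  | process => exact absurd rfl he'
  | _ => simp [step]

theorem step_process_of_queue_eq {s : State n D} {A : Finset (Vertex n D)}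
    {q : List (Finset (Vertex n D))} (h : s.queue = A :: q) :
    step f digest valid (.process : Event n D Tx) s = fairnessStep f A { s with queue := q } := by
  unfold step
  dsimp only
  rw [h]

theorem mem_dag_step {e : Event n D Tx} {s : State n D} {v : Vertex n D} :
    v ∈ (step f digest valid e s).dag ↔ v ∈ s.dag ∨ e = .deliver v := by
  by_cases he : ∀ v, e ≠ .deliver v
  · simp [step_of_ne_deliver he, he v]
  · push Not at he
    obtain ⟨w, rfl⟩ := he
    simp [step, or_comm, eq_comm]

end Step

/-! ### The local DAGs -/

section Dag

variable {n f : ℕ} {D Tx : Type*} [LinearOrder D] {digest : Tx → D} {valid : Tx → Prop}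
  {correct : Finset (Fin n)} {ev : Fin n → ℕ → Event n D Tx}

local notation "σ" => stateAt f digest valid ev

theorem mem_dag_succ {i : Fin n} {t : ℕ} {v : Vertex n D} :
    v ∈ (σ i (t + 1)).dag ↔ v ∈ (σ i t).dag ∨ ev i t = .deliver v :=
  mem_dag_step

theorem dag_mono (i : Fin n) : Monotone fun t => (σ i t).dag :=
  monotone_nat_of_le_succ fun _ _ hv => mem_dag_succ.2 (.inl hv)

theorem exists_deliver {i : Fin n} {t t' : ℕ} {v : Vertex n D} (hv : v ∉ (σ i t).dag)
    (hv' : v ∈ (σ i t').dag) : ∃ u ≥ t, ev i u = .deliver v := by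
  induction t' with
  | zero => simp [stateAt, State.init] at hv'
  | succ u ih =>
    rcases mem_dag_succ.1 hv' with h | h
    · exact ih h
    · refine ⟨u, ?_, h⟩
      by_contra hlt
      exact hv (dag_mono i (by omega : u + 1 ≤ t) hv')

theorem FollowsProtocol.valid_of_mem_dag (hprot : FollowsProtocol f digest valid correct ev)
    {i : Fin n} (hi : i ∈ correct) {t : ℕ} {v : Vertex n D} (hv : v ∈ (σ i t).dag) :
    v.ValidEdges f ∧ v.ParentsIn (σ i t).dag ∧ v.lo.Pairwise fun a b => a.1 ≠ b.1 := by
  induction t with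
  | zero => simp [stateAt, State.init] at hv
  | succ t ih =>
    have hsub := dag_mono (f := f) (digest := digest) (valid := valid) (ev := ev) i (Nat.le_succ t)
    rcases mem_dag_succ.1 hv with h | h
    · obtain ⟨h₁, h₂, h₃⟩ := ih h
      exact ⟨h₁, h₂.mono hsub, h₃⟩
    · have he := hprot.enabled i hi t
      rw [h] at he
      exact ⟨he.2.1, he.2.2.1.mono hsub, he.2.2.2.1.imp fun h => h.2⟩

/-- The delivered vertices of a creator form an initial segment of its vertices. -/
theorem FollowsProtocol.exists_mem_dag_of_le (hprot : FollowsProtocol f digest valid correct ev)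
    {i : Fin n} (hi : i ∈ correct) {t : ℕ} {v : Vertex n D} (hv : v ∈ (σ i t).dag) {r : ℕ}
    (hr : r ≤ v.round) : ∃ w ∈ (σ i t).dag, w.creator = v.creator ∧ w.round = r := by
  induction hr using Nat.decreasingInduction with
  | self => exact ⟨v, hv, rfl, rfl⟩
  | of_succ r _ ih =>
    obtain ⟨w, hw, hwc, hwr⟩ := ih
    obtain ⟨hedges, hpar, -⟩ := hprot.valid_of_mem_dag hi hw
    obtain ⟨u, hu, huc, hur⟩ := hpar.1 _ (hedges.2.1 (by omega)).2
    exact ⟨u, hu, huc.trans hwc, by omega⟩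

/-- Otherwise the chain of strong edges from `w` down its creator's own vertices meets the round of
`v`; by consistency it meets `v` itself, which would then have been delivered already. This turns
order of delivery into order of rounds, the form that `Vertex.ValidLO` needs. -/
theorem round_lt_of_deliver (hprot : FollowsProtocol f digest valid correct ev)
    (hrbc : ReliableBroadcast f digest valid correct ev)
    {i : Fin n} (hi : i ∈ correct) {t : ℕ} {v w : Vertex n D} (hv : ev i t = .deliver v)
    (hw : w ∈ (σ i t).dag) (hc : w.creator = v.creator) : w.round < v.round := by
  by_contra hlt
  obtain ⟨u, hu, huc, hur⟩ := hprot.exists_mem_dag_of_le hi hw (not_lt.1 hlt)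
  have huv : u = v := hrbc.consistency i hi i hi t (t + 1) u hu v (mem_dag_succ.2 (.inr hv))
    (huc.trans hc) hur
  have he := hprot.enabled i hi t
  rw [hv] at he
  exact he.1 (huv ▸ hu)

/-- A vertex delivered later continues the local ordering of the vertices delivered before. -/
theorem continues_of_deliver (hprot : FollowsProtocol f digest valid correct ev)
    (hrbc : ReliableBroadcast f digest valid correct ev)
    {i : Fin n} (hi : i ∈ correct) {t : ℕ} {v w : Vertex n D} (hv : ev i t = .deliver v)
    (hw : w ∈ (σ i t).dag) (hc : w.creator = v.creator) :
    ∀ a ∈ w.lo, ∀ b ∈ v.lo, a.2 ≤ b.2 ∧ a.1 ≠ b.1 := by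
  have he := hprot.enabled i hi t
  rw [hv] at he
  exact he.2.2.2.2 w hw hc (round_lt_of_deliver hprot hrbc hi hv hw hc)

/-- Stated through upper bounds, the maximum needs no special case for its default `0`, and its
monotonicity in the DAG is immediate. -/
theorem highest_le_iff {i : Fin n} {t : ℕ} {r : Fin n} {b : ℕ} :
    (σ i t).highest r ≤ b ↔
      ∀ v ∈ (σ i t).dag, v.creator = r → ∀ p ∈ v.lo, p.2 ≤ b := by
  induction t with
  | zero => simp [stateAt, State.init]
  | succ t ih =>
    by_cases he : ∀ v, ev i t ≠ .deliver v
    · obtain ⟨h₁, -, h₃⟩ := step_of_ne_deliver (f := f) (digest := digest) (valid := valid) he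
        (σ i t)
      simpa only [stateAt, h₁, h₃] using ih
    · push Not at he
      obtain ⟨v, hv⟩ := he
      have hh : (σ i (t + 1)).highest = Function.update (σ i t).highest v.creator
          (v.lo.foldl (fun m p => max m p.2) ((σ i t).highest v.creator)) := by
        simp [stateAt, hv, step]
      simp only [mem_dag_succ, hv, Event.deliver.injEq, or_imp, forall_and, forall_eq', hh]
      by_cases hr : v.creator = r
      · subst hr
        simp [foldl_max_snd_le_iff, ih]
      · simp [Function.update_of_ne (Ne.symm hr), ih, hr]

theorem seen_succ_of_deliver {i : Fin n} {t : ℕ} {v : Vertex n D} (hv : ev i t = .deliver v) :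
    (σ i (t + 1)).seen = record (σ i t).seen v := by
  simp [stateAt, hv, step]

theorem seen_succ_of_ne {i : Fin n} {t : ℕ} (he : ∀ v, ev i t ≠ .deliver v) :
    (σ i (t + 1)).seen = (σ i t).seen :=
  (step_of_ne_deliver he _).2.1

/-- A later vertex of the same creator cannot overwrite the entry, since digests are not repeated
along a local ordering. -/
theorem seen_eq_of_mem (hprot : FollowsProtocol f digest valid correct ev)
    (hrbc : ReliableBroadcast f digest valid correct ev)
    {i : Fin n} (hi : i ∈ correct) {t : ℕ} {v : Vertex n D} (hv : v ∈ (σ i t).dag) {d : D} {x : ℕ}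
    (hx : (d, x) ∈ v.lo) : (σ i t).seen d v.creator = x := by
  induction t with
  | zero => simp [stateAt, State.init] at hv
  | succ t ih =>
    rcases mem_dag_succ.1 hv with h | h
    · by_cases he : ∀ v, ev i t ≠ .deliver v
      · rw [seen_succ_of_ne he, ih h]
      · push Not at he
        obtain ⟨w, hw⟩ := he
        rw [seen_succ_of_deliver hw]
        rcases record_eq_or (σ i t).seen w d v.creator with ⟨h', -⟩ | ⟨hc, y, hy, -⟩
        · rw [h', ih h]
        · exact absurd rfl (continues_of_deliver hprot hrbc hi hw h hc.symm _ hx _ hy).2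
    · rw [seen_succ_of_deliver h]
      exact record_eq_of_mem (hprot.valid_of_mem_dag hi hv).2.2 hx

theorem seen_eq_top_or (i : Fin n) (t : ℕ) (d : D) (r : Fin n) :
    (σ i t).seen d r = ⊤ ∨
      ∃ v ∈ (σ i t).dag, v.creator = r ∧ ∃ x : ℕ, (d, x) ∈ v.lo ∧ (σ i t).seen d r = x := by
  induction t with
  | zero => simp [stateAt, State.init]
  | succ t ih =>
    have hold : (σ i (t + 1)).seen d r = (σ i t).seen d r → (σ i (t + 1)).seen d r = ⊤ ∨
        ∃ v ∈ (σ i (t + 1)).dag, v.creator = r ∧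
          ∃ x : ℕ, (d, x) ∈ v.lo ∧ (σ i (t + 1)).seen d r = x := by
      intro h
      rw [h]
      exact ih.imp_right fun ⟨v, hv, h⟩ => ⟨v, mem_dag_succ.2 (.inl hv), h⟩
    by_cases he : ∀ v, ev i t ≠ .deliver v
    · exact hold (by rw [seen_succ_of_ne he])
    · push Not at he
      obtain ⟨v, hv⟩ := he
      rcases record_eq_or (σ i t).seen v d r with ⟨h, -⟩ | ⟨hc, x, hx, h⟩
      · exact hold (by rw [seen_succ_of_deliver hv, h])
      · rw [seen_succ_of_deliver hv]
        exact .inr ⟨v, mem_dag_succ.2 (.inr hv), hc, x, hx, h⟩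

/-- No vertex that some correct replica delivers carries an indicator of `d` below the value that
enters `lpaoi`. -/
theorem min_seen_highest_le (hprot : FollowsProtocol f digest valid correct ev)
    (hrbc : ReliableBroadcast f digest valid correct ev)
    {i j : Fin n} (hi : i ∈ correct) (hj : j ∈ correct) (t : ℕ) {t' : ℕ} {v : Vertex n D}
    (hv : v ∈ (σ j t').dag) {d : D} {x : ℕ} (hx : (d, x) ∈ v.lo) :
    min ((σ i t).seen d v.creator) ((σ i t).highest v.creator : ℕ∞) ≤ x := by
  by_cases hvi : v ∈ (σ i t).dag
  · exact min_le_of_left_le (seen_eq_of_mem hprot hrbc hi hvi hx).le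
  · obtain ⟨u', hu'⟩ := hrbc.totality j hj i hi t' v hv
    obtain ⟨u, hu, hdel⟩ := exists_deliver hvi hu'
    -- Here `v` is delivered by `i` only after time `t`, so its indicators are at least all those
    -- that `highest` took into account.
    refine min_le_of_right_le (Nat.cast_le.2 (highest_le_iff.2 fun w hw hc p hp => ?_))
    exact (continues_of_deliver hprot hrbc hi hdel (dag_mono i hu hw) hc p hp _ hx).1

/-- An entry of `seen` may drop from `⊤` to a finite `x` as vertices arrive, but then `x` is at
least the earlier minimum of `seen` and `highest`, by `min_seen_highest_le`. -/
theorem lpaoi_le_lpaoi (hprot : FollowsProtocol f digest valid correct ev)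
    (hrbc : ReliableBroadcast f digest valid correct ev)
    {i j : Fin n} (hi : i ∈ correct) (hj : j ∈ correct) {t t' : ℕ}
    (hsub : (σ i t).dag ⊆ (σ j t').dag) (d : D) : lpaoi f (σ i t) d ≤ lpaoi f (σ j t') d := by
  refine kthSmallest_mono _ fun r => le_min ?_ (min_le_of_right_le (Nat.cast_le.2 ?_))
  · rcases seen_eq_top_or (f := f) (digest := digest) (valid := valid) (ev := ev) j t' d r with
      h | ⟨v, hv, rfl, x, hx, h⟩
    · rw [h]; exact le_top
    · rw [h]; exact min_seen_highest_le hprot hrbc hi hj t hv hx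
  · exact highest_le_iff.2 fun v hv hc => highest_le_iff.1 le_rfl v (hsub hv) hc

/-! ### Causal histories -/

/-- References are delivered before the vertex that makes them, and consistency lets the pair of
creator and round name the same vertex at both replicas; so a path can be copied edge by edge. -/
theorem causalHistory_subset (hprot : FollowsProtocol f digest valid correct ev)
    (hrbc : ReliableBroadcast f digest valid correct ev)
    {i j : Fin n} (hi : i ∈ correct) (hj : j ∈ correct) {t t' : ℕ} {L : Vertex n D}
    (hL' : L ∈ (σ j t').dag) :
    causalHistory (σ i t).dag L ⊆ causalHistory (σ j t').dag L := by
  intro w hw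
  obtain ⟨-, hpath⟩ := mem_causalHistory.1 hw
  clear hw
  suffices w ∈ (σ j t').dag ∧ Relation.ReflTransGen (fun a b => b ∈ (σ j t').dag ∧ a.Refs b) L w
    from mem_causalHistory.2 this
  induction hpath with
  | refl => exact ⟨hL', .refl⟩
  | @tail a b _ hab ih =>
    obtain ⟨ha, hpath⟩ := ih
    suffices b ∈ (σ j t').dag from ⟨this, hpath.tail ⟨this, hab.2⟩⟩
    obtain ⟨-, hpar, -⟩ := hprot.valid_of_mem_dag hj ha
    obtain ⟨u, hu, huc, hur⟩ : ∃ u ∈ (σ j t').dag, u.creator = b.creator ∧ u.round = b.round := by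
      rcases hab.2 with ⟨hr, hc⟩ | hmem
      · obtain ⟨u, hu, huc, hur⟩ := hpar.1 _ hc
        exact ⟨u, hu, huc, by omega⟩
      · obtain ⟨u, hu, h⟩ := hpar.2 _ hmem
        exact ⟨u, hu, (Prod.mk.inj h).1, (Prod.mk.inj h).2⟩
    rwa [← hrbc.consistency j hj i hi t' t u hu b hab.1 huc hur]

theorem causalHistory_eq (hprot : FollowsProtocol f digest valid correct ev)
    (hrbc : ReliableBroadcast f digest valid correct ev)
    {i j : Fin n} (hi : i ∈ correct) (hj : j ∈ correct) {t t' : ℕ} {L : Vertex n D}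
    (hL : L ∈ (σ i t).dag) (hL' : L ∈ (σ j t').dag) :
    causalHistory (σ i t).dag L = causalHistory (σ j t').dag L :=
  (causalHistory_subset hprot hrbc hi hj hL').antisymm
    (causalHistory_subset hprot hrbc hj hi hL)

end Dag

/-! ### Commits and subdags -/

section Commit

variable {n : ℕ} {D Tx : Type*}

/-- The leaders committed in the first `t` events, in the order of the commits. -/
def leaders (e : ℕ → Event n D Tx) : ℕ → List (Vertex n D)
  | 0 => []
  | t + 1 =>
    match e t with
    | .commit L => leaders e t ++ [L]
    | _ => leaders e t

theorem leaders_succ_of_commit {e : ℕ → Event n D Tx} {t : ℕ} {L : Vertex n D}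
    (h : e t = .commit L) : leaders e (t + 1) = leaders e t ++ [L] := by
  simp [leaders, h]

theorem leaders_succ_of_ne {e : ℕ → Event n D Tx} {t : ℕ} (h : ∀ L, e t ≠ .commit L) :
    leaders e (t + 1) = leaders e t := by
  rw [leaders]
  split
  · exact absurd ‹_› (h _)
  · rfl

theorem mem_leaders {e : ℕ → Event n D Tx} {t : ℕ} {L : Vertex n D} :
    L ∈ leaders e t ↔ ∃ u < t, e u = .commit L := by
  induction t with
  | zero => simp [leaders]
  | succ t ih =>
    simp only [Nat.lt_succ_iff_lt_or_eq, or_and_right, exists_or, exists_eq_left]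
    by_cases h : ∀ L, e t ≠ .commit L
    · simp [leaders_succ_of_ne h, ih, h L]
    · push Not at h
      obtain ⟨L', h⟩ := h
      simp [leaders_succ_of_commit h, ih, h, eq_comm]

open Classical in
/-- The union of the causal histories `H L` of the leaders `L` in a list, and the list of their
subdags. -/
noncomputable def subdags (H : Vertex n D → Finset (Vertex n D)) (l : List (Vertex n D)) :
    Finset (Vertex n D) × List (Finset (Vertex n D)) :=
  l.foldl (fun p L => (p.1 ∪ H L, p.2 ++ [H L \ p.1])) (∅, [])

open Classical in
theorem subdags_concat (H : Vertex n D → Finset (Vertex n D)) (l : List (Vertex n D))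
    (L : Vertex n D) :
    subdags H (l ++ [L]) =
      ((subdags H l).1 ∪ H L, (subdags H l).2 ++ [H L \ (subdags H l).1]) := by
  simp [subdags]

theorem subdags_prefix (H : Vertex n D → Finset (Vertex n D)) {l l' : List (Vertex n D)}
    (h : l <+: l') : (subdags H l).2 <+: (subdags H l').2 := by
  obtain ⟨m, rfl⟩ := h
  induction m using List.reverseRecOn with
  | nil => simp
  | append_singleton m L ih =>
    rw [← List.append_assoc, subdags_concat]
    exact ih.trans (List.prefix_append _ _)

end Commit

section Execution

variable {n f : ℕ} {D Tx : Type*} [LinearOrder D] {digest : Tx → D} {valid : Tx → Prop}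
  {correct : Finset (Fin n)} {ev : Fin n → ℕ → Event n D Tx}

local notation "σ" => stateAt f digest valid ev

theorem leaders_pairwise (hdag : DAGConsensus f digest valid correct ev) {i : Fin n}
    (hi : i ∈ correct) (t : ℕ) :
    (leaders (ev i) t).Pairwise fun L L' => L.round < L'.round := by
  induction t with
  | zero => simp [leaders]
  | succ t ih =>
    by_cases h : ∀ L, ev i t ≠ .commit L
    · rwa [leaders_succ_of_ne h]
    · push Not at h
      obtain ⟨L, h⟩ := h
      rw [leaders_succ_of_commit h, List.pairwise_append]
      refine ⟨ih, by simp, fun L' hL' L'' hL'' => ?_⟩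
      obtain ⟨u, hu, hcom⟩ := mem_leaders.1 hL'
      rw [List.mem_singleton.1 hL'']
      exact (hdag.totalAscendingOrder i hi u t L' L hu hcom h).1

/-- By agreement `i` commits `L'` at some time; after `L` it could only have a larger round. -/
theorem mem_leaders_of_round_lt (hdag : DAGConsensus f digest valid correct ev) {i j : Fin n}
    (hi : i ∈ correct) (hj : j ∈ correct) {t t' : ℕ} {L L' : Vertex n D}
    (hL : L ∈ leaders (ev i) t) (hL' : L' ∈ leaders (ev j) t') (hlt : L'.round < L.round) :
    L' ∈ leaders (ev i) t := by
  obtain ⟨u, hu, hcom⟩ := mem_leaders.1 hL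
  obtain ⟨w, -, hcom'⟩ := mem_leaders.1 hL'
  obtain ⟨u', hu'⟩ := hdag.agreement j hj i hi w L' hcom'
  refine mem_leaders.2 ⟨u', ?_, hu'⟩
  by_contra hge
  exact hlt.not_gt (hdag.totalAscendingOrder i hi u u' L L' (by omega) hcom hu').1

/-- Rounds sort the leaders and also identify them: by agreement `i` commits both, and its different
commits have different rounds. -/
theorem leaders_prefix_or_prefix (hdag : DAGConsensus f digest valid correct ev) {i j : Fin n}
    (hi : i ∈ correct) (hj : j ∈ correct) (t t' : ℕ) :
    leaders (ev i) t <+: leaders (ev j) t' ∨ leaders (ev j) t' <+: leaders (ev i) t := by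
  refine prefix_or_prefix_of_pairwise_lt Vertex.round (leaders_pairwise hdag hi t)
    (leaders_pairwise hdag hj t') (fun L hL L' hL' heq => ?_)
    (fun L hL L' hL' => mem_leaders_of_round_lt hdag hi hj hL hL')
    (fun L hL L' hL' => mem_leaders_of_round_lt hdag hj hi hL' hL)
  obtain ⟨u, -, hcom⟩ := mem_leaders.1 hL
  obtain ⟨w, -, hcom'⟩ := mem_leaders.1 hL'
  obtain ⟨u', hu'⟩ := hdag.agreement j hj i hi w L' hcom'
  rcases lt_trichotomy u u' with hlt | rfl | hlt
  · exact absurd heq (hdag.totalAscendingOrder i hi u u' L L' hlt hcom hu').1.ne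
  · exact Event.commit.inj (hcom.symm.trans hu')
  · exact absurd heq (hdag.totalAscendingOrder i hi u' u L' L hlt hu' hcom).1.ne'

variable (f digest valid ev) in
/-- The subdags that the fairness layer of replica `i` has received in the first `t` events. -/
noncomputable def processed (i : Fin n) : ℕ → List (Finset (Vertex n D))
  | 0 => []
  | t + 1 =>
    match ev i t with
    | .process => processed i t ++ (stateAt f digest valid ev i t).queue.head?.toList
    | _ => processed i t

local notation "π" => processed f digest valid ev

theorem processed_succ_of_ne {i : Fin n} {t : ℕ} (h : ev i t ≠ .process) :
    π i (t + 1) = π i t := by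
  rw [processed]
  split
  · exact absurd ‹_› h
  · rfl

theorem FollowsProtocol.process (hprot : FollowsProtocol f digest valid correct ev) {i : Fin n}
    (hi : i ∈ correct) {t : ℕ} (h : ev i t = .process) :
    ∃ A q, (σ i t).queue = A :: q ∧ π i (t + 1) = π i t ++ [A] ∧
      σ i (t + 1) = fairnessStep f A { σ i t with queue := q } := by
  have he := hprot.enabled i hi t
  rw [h] at he
  obtain ⟨A, q, hq⟩ := List.exists_cons_of_ne_nil he
  refine ⟨A, q, hq, by simp [processed, h, hq], ?_⟩
  rw [stateAt, h, step_process_of_queue_eq hq]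

theorem processed_mono (i : Fin n) {t t' : ℕ} (h : t ≤ t') : π i t <+: π i t' := by
  induction t', h using Nat.le_induction with
  | base => exact List.prefix_rfl
  | succ t' _ ih =>
    refine ih.trans ?_
    by_cases he : ev i t' = .process
    · simp [processed, he]
    · rw [processed_succ_of_ne he]

theorem done_succ_of_commit {i : Fin n} {t : ℕ} {L : Vertex n D} (h : ev i t = .commit L) :
    (σ i (t + 1)).queue = (σ i t).queue ++ [subdag (σ i t) L] ∧
    ∀ v, v ∈ (σ i (t + 1)).done ↔ v ∈ (σ i t).done ∨ v ∈ causalHistory (σ i t).dag L := by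
  simp [stateAt, h, step]

/-- The subdags sent to the fairness layer are determined by the committed leaders. -/
theorem subdags_leaders (hprot : FollowsProtocol f digest valid correct ev)
    {H : Vertex n D → Finset (Vertex n D)} {i : Fin n} (hi : i ∈ correct)
    (hH : ∀ t, ∀ L ∈ (σ i t).dag, causalHistory (σ i t).dag L = H L) (t : ℕ) :
    subdags H (leaders (ev i) t) = ((σ i t).done, π i t ++ (σ i t).queue) := by
  induction t with
  | zero => simp [subdags, leaders, stateAt, State.init, processed]
  | succ t ih =>
    by_cases h : ∀ L, ev i t ≠ .commit L
    · rw [leaders_succ_of_ne h, ih]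
      have hdone : (σ i (t + 1)).done = (σ i t).done := step_of_ne_commit h _
      by_cases hp : ev i t = .process
      · obtain ⟨A, q, hq, hpr, hs⟩ := hprot.process hi hp
        rw [hdone, hpr, hs, hq]
        simp [fairnessStep]
      · have hqueue : (σ i (t + 1)).queue = (σ i t).queue := step_queue_of_ne h hp _
        rw [hdone, hqueue, processed_succ_of_ne hp]
    · push Not at h
      obtain ⟨L, h⟩ := h
      have hL := hprot.enabled i hi t
      rw [h] at hL
      rw [leaders_succ_of_commit h, subdags_concat, ih, processed_succ_of_ne (by simp [h])]
      simp [stateAt, h, step, subdag, hH t L hL]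

theorem processed_prefix_or_prefix (hprot : FollowsProtocol f digest valid correct ev)
    (hrbc : ReliableBroadcast f digest valid correct ev)
    (hdag : DAGConsensus f digest valid correct ev) {i j : Fin n}
    (hi : i ∈ correct) (hj : j ∈ correct) (t t' : ℕ) :
    π i t <+: π j t' ∨ π j t' <+: π i t := by
  classical
  -- `H L` is the causal history of `L` at any correct replica that has delivered it; the value `∅`
  -- for other vertices is never used.
  obtain ⟨H, hH⟩ : ∃ H : Vertex n D → Finset (Vertex n D), ∀ k ∈ correct, ∀ t,
      ∀ L ∈ (σ k t).dag, causalHistory (σ k t).dag L = H L := by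
    refine ⟨fun L => if h : ∃ k ∈ correct, ∃ t, L ∈ (σ k t).dag then
      causalHistory (σ h.choose h.choose_spec.2.choose).dag L else ∅, fun k hk t L hL => ?_⟩
    have h : ∃ k ∈ correct, ∃ t, L ∈ (σ k t).dag := ⟨k, hk, t, hL⟩
    simp only [dif_pos h]
    exact causalHistory_eq hprot hrbc hk h.choose_spec.1 hL h.choose_spec.2.choose_spec
  have hpre : ∀ k ∈ correct, ∀ t, π k t <+: (subdags H (leaders (ev k) t)).2 := fun k hk t => by
    rw [subdags_leaders hprot hk (hH k hk)]
    exact List.prefix_append _ _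
  exact prefix_or_prefix_of_prefix
    ((leaders_prefix_or_prefix hdag hi hj t t').imp (subdags_prefix H) (subdags_prefix H))
    (hpre i hi t) (hpre j hj t')

theorem subset_dag_of_mem_processed (hprot : FollowsProtocol f digest valid correct ev) {i : Fin n}
    (hi : i ∈ correct) {t : ℕ} {A : Finset (Vertex n D)} (hA : A ∈ π i t ++ (σ i t).queue) :
    A ⊆ (σ i t).dag := by
  induction t with
  | zero => simp [processed, stateAt, State.init] at hA
  | succ t ih =>
    have hsub := dag_mono (f := f) (digest := digest) (valid := valid) (ev := ev) i (Nat.le_succ t)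
    suffices A ∈ π i t ++ (σ i t).queue ∨ A ⊆ (σ i t).dag from
      (this.elim ih id).trans hsub
    by_cases h : ∀ L, ev i t ≠ .commit L
    · by_cases hp : ev i t = .process
      · obtain ⟨B, q, hq, hpr, hs⟩ := hprot.process hi hp
        rw [hpr, hs] at hA
        rw [hq]
        exact .inl (by simpa [fairnessStep] using hA)
      · have hqueue : (σ i (t + 1)).queue = (σ i t).queue := step_queue_of_ne h hp _
        rw [hqueue, processed_succ_of_ne hp] at hA
        exact .inl hA
    · push Not at h
      obtain ⟨L, h⟩ := h
      rw [(done_succ_of_commit h).1, processed_succ_of_ne (by simp [h]), ← List.append_assoc,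
        List.mem_append, List.mem_singleton] at hA
      refine hA.imp_right ?_
      rintro rfl v hv
      exact (mem_causalHistory.1 (mem_subdag.1 hv).1).1

/-! ### Assigned ordering indicators -/

/-- `seen` and `highest`, which depend on the timing of deliveries, influence only when a digest is
ordered, not its AOI. -/
theorem outcome_processed (hprot : FollowsProtocol f digest valid correct ev) {i : Fin n}
    (hi : i ∈ correct) (t : ℕ) :
    outcome f (π i t) = ((σ i t).committed, (σ i t).aoi) := by
  induction t with
  | zero => simp [outcome, processed, stateAt, State.init]
  | succ t ih =>
    by_cases hp : ev i t = .process
    · obtain ⟨A, q, -, hpr, hs⟩ := hprot.process hi hp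
      rw [hpr, outcome_concat, ih, hs]
      rfl
    · obtain ⟨h₁, h₂, -⟩ := step_of_ne_process (f := f) (digest := digest) (valid := valid) hp
        (σ i t)
      rw [processed_succ_of_ne hp, ih, stateAt, h₁, h₂]

theorem aoi_eq_of_prefix (hprot : FollowsProtocol f digest valid correct ev) {i j : Fin n}
    (hi : i ∈ correct) (hj : j ∈ correct) {t t' : ℕ} (h : π i t <+: π j t') {d : D}
    (hd : (σ i t).aoi d ≠ ⊤) : (σ j t').aoi d = (σ i t).aoi d := by
  have := outcome_snd_eq_of_prefix (f := f) h (d := d)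
  rw [outcome_processed hprot hi, outcome_processed hprot hj] at this
  exact this hd

variable (f digest valid correct ev) in
/-- The ordering indicator that the correct replicas eventually assign to `d`; `⊤` if there is
none. -/
noncomputable def finalAOI (d : D) : ℕ∞ :=
  ⨅ i ∈ correct, ⨅ t, (stateAt f digest valid ev i t).aoi d

local notation "α" => finalAOI f digest valid correct ev

/-- All finite AOIs of `d` coincide, since the processed subdags are comparable, and the values `⊤`
do not affect the infimum. -/
theorem finalAOI_eq (hprot : FollowsProtocol f digest valid correct ev)
    (hrbc : ReliableBroadcast f digest valid correct ev)
    (hdag : DAGConsensus f digest valid correct ev) {i : Fin n} (hi : i ∈ correct) {t : ℕ} {d : D}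
    (hd : (σ i t).aoi d ≠ ⊤) : α d = (σ i t).aoi d := by
  refine le_antisymm (iInf₂_le_of_le i hi (iInf_le _ t)) (le_iInf₂ fun j hj => le_iInf fun t' => ?_)
  by_cases hd' : (σ j t').aoi d = ⊤
  · simp [hd']
  · rcases processed_prefix_or_prefix hprot hrbc hdag hi hj t t' with h | h
    · exact (aoi_eq_of_prefix hprot hi hj h hd).ge
    · exact (aoi_eq_of_prefix hprot hj hi h hd').le

/-- `lpaoi` is a lower bound for the ordering indicator assigned eventually. -/
theorem lpaoi_le_finalAOI (hprot : FollowsProtocol f digest valid correct ev)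
    (hrbc : ReliableBroadcast f digest valid correct ev) {i : Fin n} (hi : i ∈ correct) (t : ℕ)
    (d : D) : lpaoi f (σ i t) d ≤ α d := by
  refine le_iInf₂ fun j hj => le_iInf fun t' => ?_
  have := (le_outcome (f := f) (P := π j t') (d := d)
    (w := fun r => min ((σ i t).seen d r) ((σ i t).highest r : ℕ∞)) fun A hA v hv x hx =>
      min_seen_highest_le hprot hrbc hi hj t
        (subset_dag_of_mem_processed hprot hj (List.mem_append_left _ hA) hv) hx).2
  rwa [outcome_processed hprot hj] at this

/-! ### The final ordering -/

/-- The final ordering is sorted by `key`, with the digests not ordered yet above it, and the digests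
with an assigned ordering indicator are ordered or waiting in `txns`. -/
structure LogInvariant (key : D → ℕ∞) (s : State n D) : Prop where
  finite_txns : s.txns.Finite
  disjoint : ∀ d ∈ s.txns, d ∉ s.log
  mem_of_aoi : ∀ d, s.aoi d ≠ ⊤ → d ∈ s.txns ∨ d ∈ s.log
  aoi_of_mem_log : ∀ d ∈ s.log, s.aoi d ≠ ⊤
  pairwise : s.log.Pairwise fun a b => toLex (key a, a) < toLex (key b, b)
  lt_of_notMem : ∀ d ∈ s.log, ∀ e ∉ s.log, key d < key e

/-- `U` stands for the digests waiting or newly assigned, `b` for the threshold. Everything appended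
has key below `b`; everything left out has key at least `b`, by `hb` if it has no AOI and by the
choice of the batch otherwise. The gap is strict in `key` alone, so digests with equal AOI are never
split between batches. -/
theorem LogInvariant.append {key : D → ℕ∞} {s s' : State n D} (h : LogInvariant key s) {U : Set D}
    {b : ℕ∞} (hfin : U.Finite) (hU : ∀ d ∈ U, d ∈ s.txns ∨ s.aoi d = ⊤) (hsub : s.txns ⊆ U)
    (haoi : ∀ d, s.aoi d ≠ ⊤ → s'.aoi d = s.aoi d)
    (hnew : ∀ d, s'.aoi d ≠ ⊤ → s.aoi d = ⊤ → d ∈ U)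
    (hkey : ∀ d, s'.aoi d ≠ ⊤ → key d = s'.aoi d) (hb : ∀ d, s'.aoi d = ⊤ → b ≤ key d)
    (htxns : s'.txns = U \ {d ∈ U | s'.aoi d < b})
    (hlog : s'.log = s.log ++ sortBy s'.aoi {d ∈ U | s'.aoi d < b}) : LogInvariant key s' := by
  have hfin' : {d ∈ U | s'.aoi d < b}.Finite := hfin.subset fun d hd => hd.1
  have hmem : ∀ d, d ∈ s'.log ↔ d ∈ s.log ∨ d ∈ U ∧ s'.aoi d < b := fun d => by
    rw [hlog, List.mem_append, mem_sortBy hfin']; rfl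
  have hUlog : ∀ d ∈ U, d ∉ s.log := fun d hd hdl =>
    (hU d hd).elim (fun h' => h.disjoint d h' hdl) (h.aoi_of_mem_log d hdl)
  have hcover : ∀ d, s'.aoi d ≠ ⊤ → d ∈ U ∨ d ∈ s.log := fun d hd => by
    by_cases hd' : s.aoi d = ⊤
    · exact .inl (hnew d hd hd')
    · exact (h.mem_of_aoi d hd').imp_left fun h' => hsub h'
  refine ⟨htxns ▸ hfin.subset Set.sdiff_subset, fun d hd hdl => ?_, fun d hd => ?_, fun d hd => ?_,
    ?_, fun d hd e he => ?_⟩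
  · rw [htxns] at hd
    rcases (hmem d).1 hdl with h' | h'
    · exact hUlog d hd.1 h'
    · exact hd.2 h'
  · rw [htxns, hmem]
    rcases hcover d hd with h' | h'
    · by_cases hlt : s'.aoi d < b
      · exact .inr (.inr ⟨h', hlt⟩)
      · exact .inl ⟨h', fun h'' => hlt h''.2⟩
    · exact .inr (.inl h')
  · rcases (hmem d).1 hd with h' | h'
    · rw [haoi d (h.aoi_of_mem_log d h')]
      exact h.aoi_of_mem_log d h'
    · exact h'.2.ne_top
  · rw [hlog, List.pairwise_append]
    refine ⟨h.pairwise, (pairwise_sortBy _ _).imp_of_mem fun {x y} hx hy hlt => ?_,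
      fun x hx y hy => ?_⟩
    · rw [mem_sortBy hfin'] at hx hy
      rwa [hkey x hx.2.ne_top, hkey y hy.2.ne_top]
    · rw [mem_sortBy hfin'] at hy
      exact Prod.Lex.toLex_lt_toLex.2 (.inl (h.lt_of_notMem x hx y (hUlog y hy.1)))
  · rw [hmem, not_or] at he
    rcases (hmem d).1 hd with h' | h'
    · exact h.lt_of_notMem d h' e he.1
    · rw [hkey d h'.2.ne_top]
      refine h'.2.trans_le ?_
      by_cases he' : s'.aoi e = ⊤
      · exact hb e he'
      · rw [hkey e he']
        exact not_lt.1 fun hlt => he.2 ⟨(hcover e he').resolve_right he.1, hlt⟩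

variable (f digest valid ev) in
/-- The minimal `lpaoi` of the digests without an assigned ordering indicator that replica `i`
computes in its event `t`. -/
noncomputable def threshold (i : Fin n) (t : ℕ) : ℕ∞ :=
  ⨅ d, ⨅ _ : (stateAt f digest valid ev i (t + 1)).aoi d = ⊤,
    lpaoi f (stateAt f digest valid ev i t) d

local notation "θ" => threshold f digest valid ev

theorem log_succ_of_process (hprot : FollowsProtocol f digest valid correct ev) {i : Fin n}
    (hi : i ∈ correct) {t : ℕ} (h : ev i t = .process) :
    ∃ U : Set D,
      U = (σ i t).txns ∪ {d | (σ i t).aoi d = ⊤ ∧ Enough f (σ i (t + 1)).committed d} ∧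
      (∀ d, (σ i (t + 1)).aoi d ≠ ⊤ → (σ i t).aoi d = ⊤ → d ∈ U) ∧
      (σ i (t + 1)).txns = U \ {d ∈ U | (σ i (t + 1)).aoi d < θ i t} ∧
      (σ i (t + 1)).log =
        (σ i t).log ++ sortBy (σ i (t + 1)).aoi {d ∈ U | (σ i (t + 1)).aoi d < θ i t} := by
  obtain ⟨A, q, -, -, hs⟩ := hprot.process hi h
  refine ⟨_, rfl, fun d hd hd' => ?_, ?_, ?_⟩
  · refine .inr ⟨hd', ?_⟩
    rw [hs] at hd ⊢
    by_contra hne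
    simp only [fairnessStep, hd', true_and] at hd hne
    simp [hne] at hd
  -- The threshold combines the AOIs after the event with `seen` and `highest` before it, which
  -- processing does not change.
  · unfold threshold
    rw [hs]
    rfl
  · unfold threshold
    rw [hs]
    rfl

theorem logInvariant (hf : f < n) (hprot : FollowsProtocol f digest valid correct ev)
    (hrbc : ReliableBroadcast f digest valid correct ev)
    (hdag : DAGConsensus f digest valid correct ev) {i : Fin n} (hi : i ∈ correct) (t : ℕ) :
    LogInvariant α (σ i t) := by
  induction t with
  | zero => constructor <;> simp [stateAt, State.init]
  | succ t ih =>
    by_cases h : ev i t = .process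
    · obtain ⟨U, rfl, hnew, htxns, hlog⟩ := log_succ_of_process hprot hi h
      refine ih.append (ih.finite_txns.union ?_) (fun d hd => hd.imp_right fun h => h.1)
        Set.subset_union_left
        (fun d => aoi_eq_of_prefix hprot hi hi (processed_mono i (Nat.le_succ t))) hnew
        (fun d => finalAOI_eq hprot hrbc hdag hi)
        -- For `d` still without an AOI: threshold ≤ `lpaoi` ≤ final AOI.
        (fun d hd => (iInf₂_le d hd).trans (lpaoi_le_finalAOI hprot hrbc hi t d)) htxns hlog
      have hfin := finite_enough hf (π i (t + 1))
      rw [outcome_processed hprot hi] at hfin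
      exact hfin.subset fun d hd => hd.2
    · obtain ⟨-, h₂, h₃, h₄⟩ := step_of_ne_process (f := f) (digest := digest) (valid := valid) h
        (σ i t)
      constructor <;> simp only [stateAt, h₂, h₃, h₄]
      exacts [ih.finite_txns, ih.disjoint, ih.mem_of_aoi, ih.aoi_of_mem_log, ih.pairwise,
        ih.lt_of_notMem]

/-- Both logs are initial segments of the same strict order by `(α d, d)`. -/
theorem log_prefix_or_prefix (hf : f < n) (hprot : FollowsProtocol f digest valid correct ev)
    (hrbc : ReliableBroadcast f digest valid correct ev)
    (hdag : DAGConsensus f digest valid correct ev) {i j : Fin n}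
    (hi : i ∈ correct) (hj : j ∈ correct) (t t' : ℕ) :
    (σ i t).log <+: (σ j t').log ∨ (σ j t').log <+: (σ i t).log := by
  have hI := logInvariant hf hprot hrbc hdag hi t
  have hJ := logInvariant hf hprot hrbc hdag hj t'
  refine prefix_or_prefix_of_pairwise_lt (fun d => toLex (α d, d)) hI.pairwise hJ.pairwise
    (fun a _ b _ hab => (Prod.mk.inj (toLex.injective hab)).2) (fun a ha b hb hlt => ?_)
    (fun a ha b hb hlt => ?_)
  · by_contra hnot
    exact hlt.not_gt (Prod.Lex.toLex_lt_toLex.2 (.inl (hI.lt_of_notMem a ha b hnot)))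
  · by_contra hnot
    exact hlt.not_gt (Prod.Lex.toLex_lt_toLex.2 (.inl (hJ.lt_of_notMem b hb a hnot)))

theorem exists_process_of_mem_log (hprot : FollowsProtocol f digest valid correct ev) {i : Fin n}
    (hi : i ∈ correct) {t : ℕ} {d : D} (hd : d ∈ (σ i t).log) :
    ∃ u, (σ i (u + 1)).aoi d < θ i u := by
  induction t with
  | zero => simp [stateAt, State.init] at hd
  | succ t ih =>
    by_cases h : ev i t = .process
    · obtain ⟨U, -, -, -, hlog⟩ := log_succ_of_process hprot hi h
      rw [hlog, List.mem_append] at hd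
      refine hd.elim ih fun hd => ⟨t, ?_⟩
      exact (mem_of_mem_sortBy hd).2
    · rw [stateAt, (step_of_ne_process h _).2.2.2] at hd
      exact ih hd

/-! ### Progress -/

theorem done_mono (i : Fin n) : Monotone fun t => (σ i t).done := by
  refine monotone_nat_of_le_succ fun t v hv => ?_
  by_cases h : ∀ L, ev i t ≠ .commit L
  · rwa [stateAt, step_of_ne_commit h]
  · push Not at h
    obtain ⟨L, h⟩ := h
    exact ((done_succ_of_commit h).2 v).2 (.inl hv)

theorem exists_commit_ge (hprot : FollowsProtocol f digest valid correct ev)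
    (hdag : DAGConsensus f digest valid correct ev) {i : Fin n} (hi : i ∈ correct) (t : ℕ) :
    ∃ u ≥ t, ∃ L, ev i u = .commit L := by
  -- A round above all of `done`: validity puts the vertex proposed there into the subdag of a
  -- commit, which cannot have happened before `t`.
  obtain ⟨u, strong, weak, hround, hprop⟩ :=
    hprot.proposes i hi ((σ i t).done.sup Vertex.round + 1)
  obtain ⟨u', L, hcom, hv⟩ := hdag.validity i hi u strong weak hprop i hi
  refine ⟨u', ?_, L, hcom⟩
  by_contra hlt
  have hdone := done_mono i (by omega : u' + 1 ≤ t)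
    (((done_succ_of_commit hcom).2 _).2 (.inr (mem_subdag.1 hv).1))
  have := Finset.le_sup (f := Vertex.round) hdone
  simp only [newVertex, hround] at this
  omega

theorem exists_process_ge (hprot : FollowsProtocol f digest valid correct ev)
    (hdag : DAGConsensus f digest valid correct ev) {i : Fin n} (hi : i ∈ correct) (t : ℕ) :
    ∃ u ≥ t, ev i u = .process := by
  obtain ⟨u, hu, L, hcom⟩ := exists_commit_ge hprot hdag hi t
  obtain ⟨u', hu', h⟩ := hprot.processes i hi (u + 1) (by simp [(done_succ_of_commit hcom).1])
  exact ⟨u', by omega, h⟩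

theorem exists_le_length_processed (hprot : FollowsProtocol f digest valid correct ev)
    (hdag : DAGConsensus f digest valid correct ev) {i : Fin n} (hi : i ∈ correct) (k : ℕ) :
    ∃ t, k ≤ (π i t).length := by
  induction k with
  | zero => exact ⟨0, Nat.zero_le _⟩
  | succ k ih =>
    obtain ⟨t, ht⟩ := ih
    obtain ⟨u, hu, h⟩ := exists_process_ge hprot hdag hi t
    obtain ⟨A, q, -, hpr, -⟩ := hprot.process hi h
    refine ⟨u + 1, ?_⟩
    have := (processed_mono (f := f) (digest := digest) (valid := valid) (ev := ev) i hu).length_le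
    rw [hpr, List.length_append, List.length_singleton]
    omega

theorem exists_dag_subset (hrbc : ReliableBroadcast f digest valid correct ev) {i j : Fin n}
    (hi : i ∈ correct) (hj : j ∈ correct) (t : ℕ) : ∃ t', (σ i t).dag ⊆ (σ j t').dag := by
  have h : ∀ᶠ t' in Filter.atTop, ∀ v ∈ (σ i t).dag, v ∈ (σ j t').dag :=
    (Filter.eventually_all_finset _).2 fun v hv => by
      obtain ⟨t', ht'⟩ := hrbc.totality i hi j hj t v hv
      exact Filter.eventually_atTop.2 ⟨t', fun u hu => dag_mono j hu ht'⟩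
  exact h.exists

theorem exists_mem_log (hf : f < n) (hprot : FollowsProtocol f digest valid correct ev)
    (hrbc : ReliableBroadcast f digest valid correct ev)
    (hdag : DAGConsensus f digest valid correct ev) {i j : Fin n}
    (hi : i ∈ correct) (hj : j ∈ correct) {t : ℕ} {d : D} (hd : d ∈ (σ i t).log) :
    ∃ t', d ∈ (σ j t').log := by
  obtain ⟨u, hu⟩ := exists_process_of_mem_log hprot hi hd
  obtain ⟨t₁, ht₁⟩ := exists_dag_subset hrbc hi hj u
  -- For comparable lists, length decides which one is the prefix.
  obtain ⟨t₂, ht₂⟩ := exists_le_length_processed hprot hdag hj (π i (u + 1)).length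
  obtain ⟨w, hw, h⟩ := exists_process_ge hprot hdag hj (max t₁ t₂)
  have hpre : π i (u + 1) <+: π j (w + 1) := by
    have hpre₂ : π i (u + 1) <+: π j t₂ := by
      rcases processed_prefix_or_prefix hprot hrbc hdag hi hj (u + 1) t₂ with h' | h'
      · exact h'
      · rw [h'.eq_of_length_le ht₂]
    exact hpre₂.trans (processed_mono j ((le_max_right _ _).trans (hw.trans (Nat.le_succ w))))
  have haoi := fun e => aoi_eq_of_prefix hprot hi hj hpre (d := e)
  -- At `j` the infimum runs over fewer digests, because AOIs persist, and each `lpaoi` is at least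
  -- as large, because the DAG contains that of `i`.
  have hθ : θ i u ≤ θ j w := le_iInf₂ fun e he => by
    have he' : (σ i (u + 1)).aoi e = ⊤ := by
      by_contra hne
      exact hne (haoi e hne ▸ he)
    exact (iInf₂_le e he').trans (lpaoi_le_lpaoi hprot hrbc hi hj
      (ht₁.trans (dag_mono j ((le_max_left _ _).trans hw))) e)
  have hlt : (σ j (w + 1)).aoi d < θ j w := by
    rw [haoi d hu.ne_top]
    exact hu.trans_le hθ
  refine ⟨w + 1, ((logInvariant hf hprot hrbc hdag hj (w + 1)).mem_of_aoi d
    hlt.ne_top).resolve_left fun hmem => ?_⟩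
  -- After a processing event no digest with AOI below the threshold is left waiting.
  obtain ⟨U, -, -, htxns, -⟩ := log_succ_of_process hprot hj h
  rw [htxns] at hmem
  exact hmem.2 ⟨hmem.1, hlt⟩

end Execution

end FairDAG

theorem mainTheorem3 {D Tx : Type*} [LinearOrder D] (n f : ℕ) (hn : 3 * f < n)
    (digest : Tx → D) (valid : Tx → Prop)
    (correct : Finset (Fin n)) (hcorrect : correctᶜ.card ≤ f)
    (ev : Fin n → ℕ → FairDAG.Event n D Tx)
    (hprot : FairDAG.FollowsProtocol f digest valid correct ev)
    (hrbc : FairDAG.ReliableBroadcast f digest valid correct ev)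
    (hdag : FairDAG.DAGConsensus f digest valid correct ev)
    (i : Fin n) (hi : i ∈ correct) (T : Tx) (p t : ℕ)
    (hT : FairDAG.OrdersAt f digest valid ev i t T p) :
    ∀ j ∈ correct, ∃ t', FairDAG.OrdersAt f digest valid ev j t' T p := by
  intro j hj
  have hf : f < n := by omega
  obtain ⟨t', ht'⟩ :=
    FairDAG.exists_mem_log hf hprot hrbc hdag hi hj (List.mem_of_getElem? hT)
  refine ⟨t', FairDAG.getElem?_eq_some_of_prefix_or_prefix ?_
    (FairDAG.log_prefix_or_prefix hf hprot hrbc hdag hi hj t t') hT ht'⟩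
  exact (FairDAG.logInvariant hf hprot hrbc hdag hi t).pairwise.imp fun h e => by
    simp [e] at h
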